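/- Let $a,d,e\in\mathbb R$ be such that $P(x,y)=xy^2+ay-dx-e$ is irreducible in $\mathbb R[x,y]$, and let $C=\{(x,y)\in\mathbb R^2: P(x,y)=0\}$. Put $h_3(t)=\frac{-at+e}{t^2-d}\in\mathbb R(t)$ and, for $i\in\mathbb N_0$, let $$\mathcal S_{\le 3i}=\operatorname{span}_{\mathbb R}\bigl(\{h_3^i\}\cup\{h_3^j,\,h_3^jt: 1\le j\le i-1\}\cup\{1,t,\dots,t^i\}\bigr),$$ $$\mathcal T_{\le 3i}=\operatorname{span}_{\mathbb R}\bigl(\{h_3^it\}\cup\{h_3^j,\,h_3^jt: 1\le j\le i-1\}\cup\{1,t,\dots,t^i\}\bigr)$$ as subspaces of $\mathbb R(t)$. Let $\operatorname{Pos}(\mathcal S_{\le 3i})$ be the set of all $p\in\mathcal S_{\le 3i}$ with $p(t)\ge 0$ for every $t\in\mathbb R$ with $t^2\ne d$. (1) For every $k\in\mathbb N_0$ and every $p\in\operatorname{Pos}(\mathcal S_{\le 6k})$ there exist finitely many $f_i\in\mathcal S_{\le 3k}$ and $g_j\in\mathcal T_{\le 3k}$ such that $$p=\sum_i f_i^2+\sum_j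 g_j^2 .$$ (2) Let $\mathbb R[C]=\mathbb R[x,y]/I$, where $I$ is the ideal of all polynomials vanishing on $C$, let $\mathbb R[C]_{\le m}$ be the image of the polynomials of total degree at most $m$, let $Q(\mathbb R[C])$ be the total ring of fractions of $\mathbb R[C]$, and let $\widetilde C$ be the set of non-isolated points of $C$. For $k\ge 1$ put $$\mathcal B_k=\{x^k\}\cup\{x^j,\,x^jy:1\le j\le k-1\}\cup\{1,y,\dots,y^k\},\qquad \mathcal B_{V^{(k)}}=(\mathcal B_k\setminus\{x^k\})\cup\{x^ky\},$$ and let $V^{(k)}\subseteq Q(\mathbb R[C])$ be the span of $\mathcal B_{V^{(k)}}$. Then, for every $k\ge1$, $\mathcal B_k$ is a basis of $\mathbb R[C]_{\le k}$, $\mathcal B_{V^{(k)}}$ is a basis of $V^{(k)}$, $\dim_{\mathbb R}V^{(k)}=3k$, and for every $p\in\mathbb R[C]$ the following are equivalent: (a) $p\in\mathbb R[C]_{\le 2k}$ and $p(z)\ge 0$ for all $z\in\widetilde C$; (b) there exist finitely many $g_i\in\mathbb R[C]_{\le k}$ and $h_j\in V^{(k)}$ with $p=\sum_i g_i^2+\sum_j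 h_j^2$. -/

import Mathlib

noncomputable section

namespace RationalCubic

/-! ### Real plane curves and their coordinate rings -/

/-- The ring `ℝ[C] = ℝ[x,y] / I` of polynomial functions on `C ⊆ ℝ²`, where `I` is the ideal of
all polynomials vanishing on `C`. -/
abbrev CoordRing (C : Set (Fin 2 → ℝ)) : Type :=
  MvPolynomial (Fin 2) ℝ ⧸ MvPolynomial.vanishingIdeal ℝ C

/-- The total ring of fractions `Q(ℝ[C])`. -/
abbrev TotalFrac (C : Set (Fin 2 → ℝ)) : Type := FractionRing (CoordRing C)

/-- The restriction map `ℝ[x,y] → ℝ[C]`. -/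
def restrict (C : Set (Fin 2 → ℝ)) : MvPolynomial (Fin 2) ℝ →ₐ[ℝ] CoordRing C :=
  Ideal.Quotient.mkₐ ℝ (MvPolynomial.vanishingIdeal ℝ C)

/-- The value of an element of `ℝ[C]` at a point of `C`. -/
def evalAt (C : Set (Fin 2 → ℝ)) (z : C) : CoordRing C →ₐ[ℝ] ℝ :=
  Ideal.Quotient.liftₐ (MvPolynomial.vanishingIdeal ℝ C)
    (MvPolynomial.aeval (z : Fin 2 → ℝ)) (fun _ hp => hp z z.2)

/-- `ℝ[C]_{≤ m}`: the image of the polynomials of total degree at most `m`. -/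
def coordDegLE (C : Set (Fin 2 → ℝ)) (m : ℕ) : Submodule ℝ (CoordRing C) :=
  (MvPolynomial.restrictTotalDegree (Fin 2) ℝ m).map (restrict C).toLinearMap

/-- `Pos_m(D)` for `D ⊆ C`: the elements of `ℝ[C]_{≤ m}` that are nonnegative on `D`. -/
def PosOn (C D : Set (Fin 2 → ℝ)) (m : ℕ) : Set (CoordRing C) :=
  {p | p ∈ coordDegLE C m ∧ ∀ z : C, (z : Fin 2 → ℝ) ∈ D → 0 ≤ evalAt C z p}

/-- The set of non-isolated points of `C`. -/
def nonIsolated (C : Set (Fin 2 → ℝ)) : Set (Fin 2 → ℝ) :=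
  {z | z ∈ C ∧ AccPt z (Filter.principal C)}

/-- `(f, V)` is a certificate pair for `C`: for every `k ≥ 1` the space `V k ⊆ Q(ℝ[C])` has
dimension `3k`, and `p ∈ ℝ[C]` lies in `Pos_{2k}` of the set of non-isolated points of `C`
if and only if `p = ∑ gᵢ² + f ∑ hⱼ²` with finitely many `gᵢ ∈ ℝ[C]_{≤ k}` and `hⱼ ∈ V k`. -/
def IsCertificatePair (C : Set (Fin 2 → ℝ)) (f : TotalFrac C)
    (V : ℕ → Submodule ℝ (TotalFrac C)) : Prop :=
  ∀ k : ℕ, 1 ≤ k →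
    Module.finrank ℝ (V k) = 3 * k ∧
    ∀ p : CoordRing C,
      p ∈ PosOn C (nonIsolated C) (2 * k) ↔
        ∃ (m n : ℕ) (g : Fin m → CoordRing C) (h : Fin n → TotalFrac C),
          (∀ i, g i ∈ coordDegLE C k) ∧ (∀ j, h j ∈ V k) ∧
          algebraMap (CoordRing C) (TotalFrac C) p =
            ∑ i, (algebraMap (CoordRing C) (TotalFrac C) (g i)) ^ 2 + f * ∑ j, (h j) ^ 2

/-! ### The two families of monomials -/

/-- `{u^i} ∪ {u^j, u^j v : 1 ≤ j ≤ i - 1} ∪ {1, v, …, v^i}`. -/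
def basisS {A : Type*} [CommRing A] (u v : A) (i : ℕ) : Set A :=
  {u ^ i} ∪ {w | ∃ j, 1 ≤ j ∧ j < i ∧ (w = u ^ j ∨ w = u ^ j * v)} ∪ {w | ∃ l, l ≤ i ∧ w = v ^ l}

/-- `{u^i v} ∪ {u^j, u^j v : 1 ≤ j ≤ i - 1} ∪ {1, v, …, v^i}`. -/
def basisT {A : Type*} [CommRing A] (u v : A) (i : ℕ) : Set A :=
  {u ^ i * v} ∪ {w | ∃ j, 1 ≤ j ∧ j < i ∧ (w = u ^ j ∨ w = u ^ j * v)} ∪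
    {w | ∃ l, l ≤ i ∧ w = v ^ l}

/-! ### The spaces of rational functions in the parameter `t` -/

/-- The rational function `h₃ = (-a t + e) / (t² - d)` in `ℝ(t)`. -/
def h3 (a d e : ℝ) : RatFunc ℝ :=
  (-RatFunc.C a * RatFunc.X + RatFunc.C e) / (RatFunc.X ^ 2 - RatFunc.C d)

/-- The space `S_{≤ 3i}`. -/
def S (a d e : ℝ) (i : ℕ) : Submodule ℝ (RatFunc ℝ) :=
  Submodule.span ℝ (basisS (h3 a d e) RatFunc.X i)

/-- The space `T_{≤ 3i}`. -/
def T (a d e : ℝ) (i : ℕ) : Submodule ℝ (RatFunc ℝ) :=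
  Submodule.span ℝ (basisT (h3 a d e) RatFunc.X i)

/-- `Pos(S_{≤ 3i})`: the elements of `S_{≤ 3i}` that are nonnegative at every real `t` of the
domain of the parametrization, that is, at every real `t` with `t² ≠ d`. -/
def PosS (a d e : ℝ) (i : ℕ) : Set (RatFunc ℝ) :=
  {p | p ∈ S a d e i ∧ ∀ t : ℝ, t ^ 2 ≠ d → 0 ≤ RatFunc.eval (RingHom.id ℝ) t p}

/-! ### The cubic -/

/-- The polynomial `x y² + a y - d x - e`. -/
def cubic (a d e : ℝ) : MvPolynomial (Fin 2) ℝ :=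
  MvPolynomial.X 0 * MvPolynomial.X 1 ^ 2 + MvPolynomial.C a * MvPolynomial.X 1
    - MvPolynomial.C d * MvPolynomial.X 0 - MvPolynomial.C e

/-- The real zero set of the cubic. -/
def curve (a d e : ℝ) : Set (Fin 2 → ℝ) := {z | MvPolynomial.eval z (cubic a d e) = 0}

/-- The coordinate function `x` on the curve. -/
def xC (a d e : ℝ) : CoordRing (curve a d e) := restrict (curve a d e) (MvPolynomial.X 0)

/-- The coordinate function `y` on the curve. -/
def yC (a d e : ℝ) : CoordRing (curve a d e) := restrict (curve a d e) (MvPolynomial.X 1)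

/-- `B_k = {x^k, x^{k-1}, x^{k-1} y, …, x, x y, 1, y, …, y^k} ⊆ ℝ[C]`. -/
def basisB (a d e : ℝ) (k : ℕ) : Set (CoordRing (curve a d e)) :=
  basisS (xC a d e) (yC a d e) k

/-- `B_k` with `x^k` replaced by `x^k y`, as a subset of `Q(ℝ[C])`. -/
def basisV (a d e : ℝ) (k : ℕ) : Set (TotalFrac (curve a d e)) :=
  basisT (algebraMap _ (TotalFrac (curve a d e)) (xC a d e))
    (algebraMap _ (TotalFrac (curve a d e)) (yC a d e)) k

/-- The space `V^{(k)}`. -/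
def V (a d e : ℝ) (k : ℕ) : Submodule ℝ (TotalFrac (curve a d e)) :=
  Submodule.span ℝ (basisV a d e k)

end RationalCubic

end

/-!
Write `N = -a t + e` and `D = t² - d`, so that `h₃ = N / D`; irreducibility of the cubic makes
`N` and `D` coprime. The elements of `S_{≤ 3n}` (of `T_{≤ 3n}`) are the fractions `f / D ^ n` with
`deg f ≤ 3 n` whose numerator `f` is congruent modulo `D` to a real multiple of `N ^ n`
(of `t N ^ n`, for `n ≥ 1`).

The numerator `q` of a nonnegative `p ∈ S_{≤ 6k}` is a nonnegative polynomial, hence a sum of two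
squares `F ^ 2 + G ^ 2`. Modulo `D` we can write `F ≡ N ^ k (α + β t)` and `G ≡ N ^ k (γ + δ t)`,
and since `q` is congruent to a multiple of `N ^ (2 k)`, the coefficient of `t` in
`(α + β t) ^ 2 + (γ + δ t) ^ 2` vanishes: `α β + γ δ = 0`. Thus `(α, γ)` and `(β, δ)` are
orthogonal, and a rotation of the pair `(F, G)` brings `F` into `S_{≤ 3k}` and `G` into
`T_{≤ 3k}`.

The parametrization `t ↦ (h₃(t), t)` covers the whole curve and induces an injection
`ℝ[C] → ℝ(t)` that carries `ℝ[C]_{≤ k}` to `S_{≤ 3k}` and extends to `Q(ℝ[C])`, carrying `V^{(k)}`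
to `T_{≤ 3k}`.
-/

open Polynomial

namespace RationalCubic

/-! ### Nonnegative univariate polynomials -/

lemma eval_nonneg_of_finite_compl {p : ℝ[X]} {s : Set ℝ} (hs : s.Finite)
    (h : ∀ t ∉ s, 0 ≤ p.eval t) (t : ℝ) : 0 ≤ p.eval t := by
  have hclosed : IsClosed {t : ℝ | 0 ≤ p.eval t} := isClosed_le continuous_const p.continuous
  exact hclosed.closure_subset_iff.2 h (hs.countable.dense_compl ℝ t)

lemma eval_nonneg_of_mul_left {p q : ℝ[X]} (hp0 : p ≠ 0) (hp : ∀ t, 0 ≤ p.eval t)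
    (hpq : ∀ t, 0 ≤ (p * q).eval t) : ∀ t, 0 ≤ q.eval t := by
  refine eval_nonneg_of_finite_compl (p.finite_setOfPred_isRoot hp0) fun t ht => ?_
  exact nonneg_of_mul_nonneg_right (eval_mul (R := ℝ) ▸ hpq t) ((hp t).lt_of_ne' ht)

lemma sq_X_sub_C_dvd_of_nonneg {p : ℝ[X]} (hp : ∀ t, 0 ≤ p.eval t) {x : ℝ} (hx : p.IsRoot x) :
    (X - C x) ^ 2 ∣ p := by
  obtain ⟨q, rfl⟩ := dvd_iff_isRoot.2 hx
  have hmin : IsLocalMin (fun t => ((X - C x) * q).eval t) x :=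
    Filter.Eventually.of_forall fun t => by simpa using hp t
  have hderiv := hmin.hasDerivAt_eq_zero (((X - C x) * q).hasDerivAt x)
  have hroot : q.IsRoot x := by simpa using hderiv
  exact pow_two (X - C x) ▸ mul_dvd_mul_left _ (dvd_iff_isRoot.2 hroot)

lemma exists_sq_add_sq_dvd_of_nonneg {p : ℝ[X]} (hp : ∀ t, 0 ≤ p.eval t)
    (hdeg : p.degree ≠ 0) : ∃ x y : ℝ, (X - C x) ^ 2 + C y ^ 2 ∣ p := by
  obtain ⟨z, hz⟩ := IsAlgClosed.exists_aeval_eq_zero ℂ p hdeg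
  refine ⟨z.re, z.im, ?_⟩
  by_cases him : z.im = 0
  · obtain ⟨x, rfl⟩ : ∃ x : ℝ, (x : ℂ) = z := ⟨z.re, Complex.ext rfl him.symm⟩
    have hroot : p.IsRoot x := by
      simpa using (aeval_algebraMap_apply_eq_algebraMap_eval (A := ℂ) x p).symm.trans hz
    simpa using sq_X_sub_C_dvd_of_nonneg hp hroot
  · convert p.quadratic_dvd_of_aeval_eq_zero_im_ne_zero hz him using 1
    rw [← Complex.normSq_eq_norm_sq, Complex.normSq_apply]
    simp only [C_mul, C_add, C_ofNat]
    ring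

lemma natDegree_X_sub_C_sq_add_C_sq (x y : ℝ) :
    ((X - C x) ^ 2 + C y ^ 2 : ℝ[X]).natDegree = 2 := by
  rw [← C_pow, natDegree_add_C, natDegree_pow, natDegree_X_sub_C, mul_one]

theorem exists_eq_sq_add_sq_of_nonneg (p : ℝ[X]) (hp : ∀ t, 0 ≤ p.eval t) :
    ∃ f g : ℝ[X], p = f ^ 2 + g ^ 2 := by
  induction hn : p.natDegree using Nat.strong_induction_on generalizing p with
  | _ n ih =>
    by_cases hconst : p.natDegree = 0
    · obtain ⟨c, rfl⟩ := natDegree_eq_zero.1 hconst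
      have hc : 0 ≤ c := by simpa using hp 0
      exact ⟨C √c, 0, by rw [← C_pow, Real.sq_sqrt hc]; simp⟩
    obtain ⟨x, y, q, rfl⟩ :=
      exists_sq_add_sq_dvd_of_nonneg hp fun h => hconst (natDegree_eq_of_degree_eq_some h)
    have hw0 := ne_zero_of_natDegree_gt
      ((natDegree_X_sub_C_sq_add_C_sq x y).symm ▸ two_pos : 0 < _)
    have hq0 : q ≠ 0 := by rintro rfl; simp at hconst
    rw [natDegree_mul hw0 hq0, natDegree_X_sub_C_sq_add_C_sq] at hn
    have hq := eval_nonneg_of_mul_left hw0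
      (fun t => by rw [eval_add, eval_pow, eval_pow]; positivity) hp
    obtain ⟨f, g, hfg⟩ := ih q.natDegree (by omega) q hq rfl
    exact sq_add_sq_mul rfl hfg

lemma two_mul_natDegree_le_natDegree_sq_add_sq {K : Type*} [Field K] [LinearOrder K]
    [IsStrictOrderedRing K] (f g : K[X]) : 2 * f.natDegree ≤ (f ^ 2 + g ^ 2).natDegree := by
  rcases eq_or_ne f 0 with rfl | hf
  · simp
  have hlead : (f ^ 2).leadingCoeff + (g ^ 2).leadingCoeff ≠ 0 := by
    have := leadingCoeff_ne_zero.2 hf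
    rw [leadingCoeff_pow, leadingCoeff_pow]
    positivity
  rw [← natDegree_pow]
  refine natDegree_le_natDegree ?_
  rw [degree_add_eq_of_leadingCoeff_add_ne_zero hlead]
  exact le_max_left _ _

/-! ### Evaluation of regular rational functions -/

section RegularAt

variable {K : Type*} [Field K]

/-- The local ring of rational functions defined at `t`. On it `RatFunc.eval` is multiplicative
and additive, while outside it takes the junk value `0`. -/
noncomputable def regularAt (t : K) : Subalgebra K (RatFunc K) where
  carrier := {r | r.denom.eval t ≠ 0}
  mul_mem' {r s} hr hs h :=
    mul_ne_zero hr hs (eval_mul (R := K) ▸ eval_eq_zero_of_dvd_of_eval_eq_zero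
      (RatFunc.denom_mul_dvd r s) h)
  add_mem' {r s} hr hs h :=
    mul_ne_zero hr hs (eval_mul (R := K) ▸ eval_eq_zero_of_dvd_of_eval_eq_zero
      (RatFunc.denom_add_dvd r s) h)
  algebraMap_mem' c := by simp [RatFunc.algebraMap_eq_C]

/-- Evaluation at `t` of the rational functions defined at `t`. -/
noncomputable def evalRegularAt (t : K) : regularAt t →ₐ[K] K where
  toFun r := RatFunc.eval (RingHom.id K) t r
  map_one' := RatFunc.eval_one _ _
  map_mul' r s := RatFunc.eval_mul _ _ r.2 s.2
  map_zero' := RatFunc.eval_zero _ _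
  map_add' r s := RatFunc.eval_add _ _ r.2 s.2
  commutes' c := by simp [RatFunc.algebraMap_eq_C]

lemma evalRegularAt_apply (t : K) (r : regularAt t) :
    evalRegularAt t r = RatFunc.eval (RingHom.id K) t r := rfl

lemma algebraMap_mem_regularAt (t : K) (p : K[X]) :
    algebraMap K[X] (RatFunc K) p ∈ regularAt t := by
  change (algebraMap K[X] (RatFunc K) p).denom.eval t ≠ 0
  simp

lemma ratFunc_eval_algebraMap (t : K) (p : K[X]) :
    RatFunc.eval (RingHom.id K) t (algebraMap K[X] (RatFunc K) p) = p.eval t := by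
  rw [RatFunc.eval_algebraMap, Algebra.algebraMap_self, RingHom.id_apply, eval₂_id]

lemma div_mem_regularAt {t : K} (p : K[X]) {q : K[X]} (hq : q.eval t ≠ 0) :
    algebraMap K[X] (RatFunc K) p / algebraMap K[X] (RatFunc K) q ∈ regularAt t := fun h =>
  hq (eval_eq_zero_of_dvd_of_eval_eq_zero (RatFunc.denom_div_dvd p q) h)

lemma eval_mul_algebraMap {t : K} {r : RatFunc K} (hr : r ∈ regularAt t) (p : K[X]) :
    RatFunc.eval (RingHom.id K) t (r * algebraMap K[X] (RatFunc K) p) =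
      RatFunc.eval (RingHom.id K) t r * p.eval t := by
  rw [RatFunc.eval_mul _ _ hr (algebraMap_mem_regularAt t p), ratFunc_eval_algebraMap]

lemma eq_zero_of_infinite_eval_eq_zero {r : RatFunc K} {s : Set K} (hs : s.Infinite)
    (hreg : ∀ t ∈ s, r ∈ regularAt t) (h : ∀ t ∈ s, RatFunc.eval (RingHom.id K) t r = 0) :
    r = 0 := by
  refine RatFunc.num_eq_zero_iff.1 (eq_zero_of_infinite_isRoot _ (hs.mono fun t ht => ?_))
  simpa [RatFunc.eval, div_eq_zero_iff, show r.denom.eval t ≠ 0 from hreg t ht] using h t ht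

lemma eval_sum_sq_nonneg [LinearOrder K] [IsStrictOrderedRing K] {ι : Type*} [Fintype ι] {t : K}
    {r : ι → RatFunc K} (hr : ∀ i, r i ∈ regularAt t) :
    0 ≤ RatFunc.eval (RingHom.id K) t (∑ i, r i ^ 2) := by
  lift r to ι → regularAt t using hr
  have h : 0 ≤ evalRegularAt t (∑ i, r i ^ 2) := by
    simp only [map_sum, map_pow]
    positivity
  have hcoe : ∑ i, (r i : RatFunc K) ^ 2 = ((∑ i, r i ^ 2 : regularAt t) : RatFunc K) := by simp
  rwa [hcoe, ← evalRegularAt_apply]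

end RegularAt

/-! ### The numerator and the denominator of `h₃` -/

/-- The numerator `-a t + e` of `h3 a d e`. -/
noncomputable def numPoly (a e : ℝ) : ℝ[X] := -C a * X + C e

/-- The denominator `t ^ 2 - d` of `h3 a d e`. -/
noncomputable def denPoly (d : ℝ) : ℝ[X] := X ^ 2 - C d

lemma natDegree_numPoly_le (a e : ℝ) : (numPoly a e).natDegree ≤ 1 := by
  rw [numPoly, ← C_neg]
  exact natDegree_linear_le

lemma monic_denPoly (d : ℝ) : (denPoly d).Monic := monic_X_pow_sub_C d two_ne_zero

lemma denPoly_ne_zero (d : ℝ) : denPoly d ≠ 0 := (monic_denPoly d).ne_zero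

lemma natDegree_denPoly (d : ℝ) : (denPoly d).natDegree = 2 := natDegree_X_pow_sub_C

@[simp]
lemma eval_numPoly (a e t : ℝ) : (numPoly a e).eval t = -a * t + e := by simp [numPoly]

@[simp]
lemma eval_denPoly (d t : ℝ) : (denPoly d).eval t = t ^ 2 - d := by simp [denPoly]

lemma finite_setOf_sq_eq (d : ℝ) : {t : ℝ | t ^ 2 = d}.Finite :=
  ((denPoly d).finite_setOfPred_isRoot (denPoly_ne_zero d)).subset fun t ht => by
    simpa [sub_eq_zero] using ht

lemma h3_eq_div (a d e : ℝ) : h3 a d e =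
    algebraMap ℝ[X] (RatFunc ℝ) (numPoly a e) / algebraMap ℝ[X] (RatFunc ℝ) (denPoly d) := by
  simp [h3, numPoly, denPoly]

lemma h3_mem_regularAt (a e : ℝ) {d t : ℝ} (ht : t ^ 2 ≠ d) : h3 a d e ∈ regularAt t := by
  rw [h3_eq_div]
  exact div_mem_regularAt _ (by simpa [sub_eq_zero] using ht)

lemma X_mem_regularAt {K : Type*} [Field K] (t : K) : RatFunc.X ∈ regularAt t :=
  RatFunc.algebraMap_X (K := K) ▸ algebraMap_mem_regularAt t X

/-! ### Fractions with a power of `t² - d` as denominator -/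

/-- The map `f ↦ f / (t ^ 2 - d) ^ n` from polynomials to rational functions. -/
noncomputable def divDenPow (d : ℝ) (n : ℕ) : ℝ[X] →ₗ[ℝ] RatFunc ℝ :=
  LinearMap.mulRight ℝ (algebraMap ℝ[X] (RatFunc ℝ) (denPoly d) ^ n)⁻¹ ∘ₗ
    (IsScalarTower.toAlgHom ℝ ℝ[X] (RatFunc ℝ)).toLinearMap

lemma divDenPow_apply (d : ℝ) (n : ℕ) (f : ℝ[X]) :
    divDenPow d n f = algebraMap ℝ[X] (RatFunc ℝ) f / algebraMap ℝ[X] (RatFunc ℝ) (denPoly d) ^ n :=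
  (div_eq_mul_inv _ _).symm

lemma algebraMap_denPoly_ne_zero (d : ℝ) : algebraMap ℝ[X] (RatFunc ℝ) (denPoly d) ≠ 0 :=
  RatFunc.algebraMap_ne_zero (denPoly_ne_zero d)

lemma divDenPow_mul_pow (d : ℝ) (n : ℕ) (f : ℝ[X]) :
    divDenPow d n f * algebraMap ℝ[X] (RatFunc ℝ) (denPoly d ^ n) =
      algebraMap ℝ[X] (RatFunc ℝ) f := by
  rw [divDenPow_apply, map_pow, div_mul_cancel₀ _ (pow_ne_zero n (algebraMap_denPoly_ne_zero d))]

lemma divDenPow_injective (d : ℝ) (n : ℕ) : Function.Injective (divDenPow d n) := fun f g h =>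
  RatFunc.algebraMap_injective ℝ (by rw [← divDenPow_mul_pow d n f, h, divDenPow_mul_pow])

lemma divDenPow_sq (d : ℝ) (n : ℕ) (f : ℝ[X]) :
    divDenPow d n f ^ 2 = divDenPow d (2 * n) (f ^ 2) := by
  simp only [divDenPow_apply, div_pow, map_pow, ← pow_mul, mul_comm]

lemma divDenPow_mul_den_pow (d : ℝ) {m n : ℕ} (hmn : m ≤ n) (f : ℝ[X]) :
    divDenPow d n (f * denPoly d ^ (n - m)) = divDenPow d m f := by
  have hD := algebraMap_denPoly_ne_zero d
  rw [divDenPow_apply, divDenPow_apply, map_mul, map_pow, div_eq_div_iff (pow_ne_zero _ hD)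
    (pow_ne_zero _ hD), mul_assoc, pow_sub_mul_pow _ hmn]

lemma divDenPow_succ_den_mul (d : ℝ) (n : ℕ) (f : ℝ[X]) :
    divDenPow d (n + 1) (denPoly d * f) = divDenPow d n f := by
  simpa [mul_comm] using divDenPow_mul_den_pow d n.le_succ f

lemma divDenPow_num_pow_mul (a d e : ℝ) (n : ℕ) (f : ℝ[X]) :
    divDenPow d n (numPoly a e ^ n * f) = h3 a d e ^ n * algebraMap ℝ[X] (RatFunc ℝ) f := by
  rw [divDenPow_apply, h3_eq_div, map_mul, map_pow, div_pow, div_mul_eq_mul_div]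

lemma eval_nonneg_of_divDenPow {d : ℝ} {n : ℕ} {f : ℝ[X]}
    (h : ∀ t, t ^ 2 ≠ d → 0 ≤ RatFunc.eval (RingHom.id ℝ) t (divDenPow d (2 * n) f)) (t : ℝ) :
    0 ≤ f.eval t := by
  refine eval_nonneg_of_finite_compl (finite_setOf_sq_eq d) (fun t ht => ?_) t
  have hreg : divDenPow d (2 * n) f ∈ regularAt t := by
    rw [divDenPow_apply, ← map_pow]
    refine div_mem_regularAt f ?_
    rw [eval_pow, eval_denPoly]
    exact pow_ne_zero _ (sub_ne_zero.2 ht)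
  have heval := eval_mul_algebraMap hreg (denPoly d ^ (2 * n))
  rw [divDenPow_mul_pow, ratFunc_eval_algebraMap, eval_pow, pow_mul] at heval
  rw [heval]
  exact mul_nonneg (h t ht) (by positivity)

/-! ### The monomials spanning `S` and `T` -/

section Monomials

variable {A : Type*} [CommRing A]

/-- The monomial `u ^ i * v ^ j` with exponent `(i, j)`. -/
def bivariateMonomial (u v : A) (p : ℕ × ℕ) : A := u ^ p.1 * v ^ p.2

/-- The exponents of the monomials that `basisS u v n` and `basisT u v n` have in common. -/
def lowExponents (n : ℕ) : Finset (ℕ × ℕ) :=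
  Finset.Ico 1 n ×ˢ Finset.range 2 ∪ {0} ×ˢ Finset.range (n + 1)

/-- The exponents of the monomials in `basisS u v n` for `ε = 0` and in `basisT u v n` for
`ε = 1`. -/
def exponents (ε n : ℕ) : Finset (ℕ × ℕ) := insert (n, ε) (lowExponents n)

lemma mem_lowExponents {n m l : ℕ} :
    (m, l) ∈ lowExponents n ↔ ((1 ≤ m ∧ m < n) ∧ l < 2) ∨ (m = 0 ∧ l ≤ n) := by
  simp only [lowExponents, Finset.mem_union, Finset.mem_product, Finset.mem_Ico, Finset.mem_range,
    Finset.mem_singleton, Order.lt_add_one_iff]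

lemma mem_exponents {ε n m l : ℕ} :
    (m, l) ∈ exponents ε n ↔ (m = n ∧ l = ε) ∨ (m, l) ∈ lowExponents n := by
  simp [exponents]

lemma card_exponents_le (ε : ℕ) {n : ℕ} (hn : n ≠ 0) : (exponents ε n).card ≤ 3 * n := by
  have hcard := (Finset.card_insert_le (n, ε) (lowExponents n)).trans
    (Nat.add_le_add_right (Finset.card_union_le _ _) 1)
  simp only [Finset.card_product, Nat.card_Ico, Finset.card_range, Finset.card_singleton] at hcard
  exact hcard.trans (by omega)

lemma image_lowExponents (u v : A) (n : ℕ) : bivariateMonomial u v '' lowExponents n =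
    {w | ∃ j, 1 ≤ j ∧ j < n ∧ (w = u ^ j ∨ w = u ^ j * v)} ∪ {w | ∃ l, l ≤ n ∧ w = v ^ l} := by
  ext w
  constructor
  · rintro ⟨⟨m, l⟩, hml, rfl⟩
    rcases mem_lowExponents.1 hml with ⟨⟨hm, hmn⟩, hl⟩ | ⟨rfl, hl⟩
    · refine .inl ⟨m, hm, hmn, ?_⟩
      interval_cases l <;> simp [bivariateMonomial]
    · exact .inr ⟨l, hl, by simp [bivariateMonomial]⟩
  · rintro (⟨j, hj, hjn, rfl | rfl⟩ | ⟨l, hl, rfl⟩)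
    · exact ⟨(j, 0), mem_lowExponents.2 (.inl ⟨⟨hj, hjn⟩, two_pos⟩), by simp [bivariateMonomial]⟩
    · exact ⟨(j, 1), mem_lowExponents.2 (.inl ⟨⟨hj, hjn⟩, one_lt_two⟩), by
        simp [bivariateMonomial]⟩
    · exact ⟨(0, l), mem_lowExponents.2 (.inr ⟨rfl, hl⟩), by simp [bivariateMonomial]⟩

lemma basisS_eq_image (u v : A) (n : ℕ) :
    basisS u v n = bivariateMonomial u v '' exponents 0 n := by
  rw [exponents, Finset.coe_insert, Set.image_insert_eq, image_lowExponents, basisS,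
    Set.union_assoc, Set.singleton_union]
  simp [bivariateMonomial]

lemma basisT_eq_image (u v : A) (n : ℕ) :
    basisT u v n = bivariateMonomial u v '' exponents 1 n := by
  rw [exponents, Finset.coe_insert, Set.image_insert_eq, image_lowExponents, basisT,
    Set.union_assoc, Set.singleton_union]
  simp [bivariateMonomial]

lemma comp_bivariateMonomial {B F : Type*} [CommRing B] [FunLike F A B] [RingHomClass F A B]
    (φ : F) (u v : A) : φ ∘ bivariateMonomial u v = bivariateMonomial (φ u) (φ v) := by
  ext p
  simp [bivariateMonomial]

end Monomials

/-! ### The spaces of numerators -/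

lemma exists_dvd_sub_linear_mul {K : Type*} [Field K] {M D : K[X]} (hD : D.Monic)
    (hdeg : D.natDegree = 2) (hMD : IsCoprime M D) (f : K[X]) :
    ∃ α β : K, D ∣ f - (C β * X + C α) * M := by
  obtain ⟨u, v, huv⟩ := hMD
  have hrem : (f * u %ₘ D).natDegree < 2 :=
    hdeg ▸ natDegree_modByMonic_lt _ hD (by rintro rfl; simp at hdeg)
  obtain ⟨β, α, hlin⟩ := exists_eq_X_add_C_of_natDegree_le_one (Nat.le_of_lt_succ hrem)
  refine ⟨α, β, f * v + (f * u /ₘ D) * M, ?_⟩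
  have hdiv := modByMonic_add_div (f * u) D
  rw [hlin] at hdiv
  linear_combination -f * huv - M * hdiv

lemma natDegree_le_of_denPoly_mul {d : ℝ} {r : ℝ[X]} {m : ℕ}
    (h : (denPoly d * r).natDegree ≤ m + 2) : r.natDegree ≤ m := by
  rcases eq_or_ne r 0 with rfl | hr
  · simp
  · rw [natDegree_mul (denPoly_ne_zero d) hr, natDegree_denPoly] at h
    omega

section Numerators

variable {a d e : ℝ} {ε n : ℕ} {f : ℝ[X]}

variable (a d e ε n) in
/-- The polynomials of degree at most `3 n` that are congruent modulo `t ^ 2 - d` to a scalar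
multiple of `N ^ n * t ^ ε`, where `N` is the numerator of `h3 a d e`. For `ε = 0` and `ε = 1` these
are the numerators over `(t ^ 2 - d) ^ n` of the elements of `S a d e n` and, if `n ≠ 0`, of
`T a d e n`. -/
noncomputable def numerators : Submodule ℝ ℝ[X] :=
  degreeLT ℝ (3 * n + 1) ⊓
    (Submodule.span ℝ {numPoly a e ^ n * X ^ ε} ⊔ (Ideal.span {denPoly d}).restrictScalars ℝ)

lemma mem_numerators : f ∈ numerators a d e ε n ↔
    f.natDegree ≤ 3 * n ∧ ∃ c : ℝ, denPoly d ∣ f - C c * (numPoly a e ^ n * X ^ ε) := by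
  simp only [numerators, Submodule.mem_inf, degreeLT_succ_eq_degreeLE, mem_degreeLE,
    natDegree_le_iff_degree_le, Submodule.mem_sup, Submodule.restrictScalars_mem,
    Ideal.mem_span_singleton, Submodule.mem_span_singleton (R := ℝ), smul_eq_C_mul]
  refine and_congr_right fun _ => ⟨?_, ?_⟩
  · rintro ⟨_, ⟨c, rfl⟩, g, hg, rfl⟩
    exact ⟨c, by rwa [add_sub_cancel_left]⟩
  · rintro ⟨c, hc⟩
    exact ⟨_, ⟨c, rfl⟩, _, hc, add_sub_cancel _ _⟩

lemma sq_mem_numerators (hf : f ∈ numerators a d e ε n) : f ^ 2 ∈ numerators a d e 0 (2 * n) := by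
  obtain ⟨hdeg, c, q, hq⟩ := mem_numerators.1 hf
  refine mem_numerators.2 ⟨natDegree_pow_le.trans (by omega), c ^ 2 * d ^ ε, ?_⟩
  obtain ⟨r, hr⟩ : denPoly d ∣ (X ^ 2) ^ ε - C d ^ ε := sub_dvd_pow_sub_pow _ _ ε
  refine ⟨q * (f + C c * (numPoly a e ^ n * X ^ ε)) + C c ^ 2 * numPoly a e ^ (2 * n) * r, ?_⟩
  rw [C_mul, C_pow, C_pow]
  linear_combination (f + C c * (numPoly a e ^ n * X ^ ε)) * hq +
    C c ^ 2 * numPoly a e ^ (2 * n) * hr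

lemma natDegree_num_pow_mul_X_pow_le (a e : ℝ) (m l : ℕ) :
    (numPoly a e ^ m * X ^ l).natDegree ≤ m + l :=
  natDegree_mul_le_of_le
    ((natDegree_pow_le_of_le m (natDegree_numPoly_le a e)).trans_eq (mul_one m))
    (natDegree_X_pow_le l)

lemma num_pow_mul_X_pow_mul_den_pow_mem_numerators {m l : ℕ} (hmn : m ≤ n) (hl : l ≤ n + m)
    (h : m < n ∨ l = ε) :
    numPoly a e ^ m * X ^ l * denPoly d ^ (n - m) ∈ numerators a d e ε n := by
  refine mem_numerators.2 ⟨?_, ?_⟩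
  · refine (natDegree_mul_le_of_le (natDegree_num_pow_mul_X_pow_le a e m l)
      (natDegree_pow_le_of_le _ (natDegree_denPoly d).le)).trans (by omega)
  · rcases hmn.lt_or_eq with hlt | rfl
    · refine ⟨0, ?_⟩
      rw [C_0, zero_mul, sub_zero]
      exact (dvd_pow_self _ (Nat.sub_ne_zero_of_lt hlt)).mul_left _
    · obtain rfl := h.resolve_left (lt_irrefl m)
      exact ⟨1, by simp⟩

lemma bivariateMonomial_mem_map_numerators {m l : ℕ} (hmn : m ≤ n) (hl : l ≤ n + m)
    (h : m < n ∨ l = ε) : bivariateMonomial (h3 a d e) RatFunc.X (m, l) ∈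
      (numerators a d e ε n).map (divDenPow d n) := by
  refine ⟨_, num_pow_mul_X_pow_mul_den_pow_mem_numerators hmn hl h, ?_⟩
  rw [divDenPow_mul_den_pow d hmn, divDenPow_num_pow_mul, map_pow, RatFunc.algebraMap_X]
  rfl

lemma span_exponents_le_map_numerators (hε : ε ≤ 2 * n) :
    Submodule.span ℝ (bivariateMonomial (h3 a d e) RatFunc.X '' exponents ε n) ≤
      (numerators a d e ε n).map (divDenPow d n) := by
  rw [Submodule.span_le, Set.image_subset_iff]
  rintro ⟨m, l⟩ hml
  rcases mem_exponents.1 hml with ⟨rfl, rfl⟩ | hml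
  · exact bivariateMonomial_mem_map_numerators le_rfl (by omega) (.inr rfl)
  · rcases mem_lowExponents.1 hml with ⟨⟨hm, hmn⟩, hl⟩ | ⟨rfl, hl⟩ <;>
      exact bivariateMonomial_mem_map_numerators (by omega) (by omega) (by omega)

lemma bivariateMonomial_mem_span_lowExponents {A : Type*} [CommRing A] [Algebra ℝ A] (u v : A)
    {m l : ℕ} (h : (m, l) ∈ lowExponents n) :
    u ^ m * v ^ l ∈ Submodule.span ℝ (bivariateMonomial u v '' lowExponents n) :=
  Submodule.subset_span ⟨(m, l), h, rfl⟩

lemma divDenPow_linear_mul_num_pow (a d e α β : ℝ) (n : ℕ) :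
    divDenPow d n ((C β * X + C α) * numPoly a e ^ n) =
      α • (h3 a d e ^ n * RatFunc.X ^ 0) + β • (h3 a d e ^ n * RatFunc.X ^ 1) := by
  rw [mul_comm, divDenPow_num_pow_mul]
  simp only [map_add, map_mul, RatFunc.algebraMap_C, RatFunc.algebraMap_X, RatFunc.smul_eq_C_mul]
  ring

lemma divDenPow_mem_span_lowExponents (hco : IsCoprime (numPoly a e) (denPoly d)) {j : ℕ}
    (hj : j < n) (hdeg : f.natDegree ≤ n + 2 * j) : divDenPow d j f ∈
      Submodule.span ℝ (bivariateMonomial (h3 a d e) RatFunc.X '' lowExponents n) := by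
  induction j generalizing f with
  | zero =>
    rw [f.as_sum_range_C_mul_X_pow, map_sum]
    refine Submodule.sum_mem _ fun l hl => ?_
    have hmem := bivariateMonomial_mem_span_lowExponents (h3 a d e) RatFunc.X
      (mem_lowExponents.2 (.inr ⟨rfl, (Finset.mem_range_succ_iff.1 hl).trans hdeg⟩))
    simpa [divDenPow_apply, RatFunc.smul_eq_C_mul] using Submodule.smul_mem _ (f.coeff l) hmem
  | succ j ih =>
    obtain ⟨α, β, r, hr⟩ := exists_dvd_sub_linear_mul (monic_denPoly d) (natDegree_denPoly d)
      (hco.pow_left (m := j + 1)) f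
    have hrdeg : r.natDegree ≤ n + 2 * j := by
      refine natDegree_le_of_denPoly_mul (d := d) ?_
      rw [← hr]
      refine (natDegree_sub_le_of_le hdeg (natDegree_mul_le_of_le natDegree_linear_le
        (natDegree_pow_le_of_le _ (natDegree_numPoly_le a e)))).trans ?_
      omega
    have hlow (l : ℕ) (hl : l < 2) := bivariateMonomial_mem_span_lowExponents (h3 a d e) RatFunc.X
      (mem_lowExponents.2 (.inl ⟨⟨j.succ_pos, hj⟩, hl⟩))
    rw [eq_add_of_sub_eq hr, map_add, divDenPow_succ_den_mul, divDenPow_linear_mul_num_pow]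
    exact add_mem (ih (by omega) hrdeg) (add_mem (Submodule.smul_mem _ _ (hlow 0 two_pos))
      (Submodule.smul_mem _ _ (hlow 1 one_lt_two)))

lemma divDenPow_mem_span_lowExponents_of_dvd (hco : IsCoprime (numPoly a e) (denPoly d))
    (hf : denPoly d ∣ f) (hdeg : f.natDegree ≤ max 1 (3 * n)) : divDenPow d n f ∈
      Submodule.span ℝ (bivariateMonomial (h3 a d e) RatFunc.X '' lowExponents n) := by
  cases n with
  | zero =>
    have hlt : f.natDegree < (denPoly d).natDegree := by rw [natDegree_denPoly]; omega
    rw [eq_zero_of_dvd_of_natDegree_lt hf hlt, map_zero]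
    exact zero_mem _
  | succ n =>
    obtain ⟨r, rfl⟩ := hf
    have hr : r.natDegree ≤ n + 1 + 2 * n := natDegree_le_of_denPoly_mul (hdeg.trans (by omega))
    rw [divDenPow_succ_den_mul]
    exact divDenPow_mem_span_lowExponents hco n.lt_succ_self hr

lemma map_numerators_le_span_exponents (hco : IsCoprime (numPoly a e) (denPoly d)) (hε : ε ≤ 1) :
    (numerators a d e ε n).map (divDenPow d n) ≤
      Submodule.span ℝ (bivariateMonomial (h3 a d e) RatFunc.X '' exponents ε n) := by
  rintro _ ⟨f, hf, rfl⟩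
  obtain ⟨hdeg, c, hc⟩ := mem_numerators.1 hf
  have hrest : divDenPow d n (f - C c * (numPoly a e ^ n * X ^ ε)) ∈
      Submodule.span ℝ (bivariateMonomial (h3 a d e) RatFunc.X '' lowExponents n) := by
    refine divDenPow_mem_span_lowExponents_of_dvd hco hc ((natDegree_sub_le_of_le hdeg
      ((natDegree_C_mul_le c _).trans (natDegree_num_pow_mul_X_pow_le a e n ε))).trans ?_)
    omega
  have htop : divDenPow d n (C c * (numPoly a e ^ n * X ^ ε)) =
      c • bivariateMonomial (h3 a d e) RatFunc.X (n, ε) := by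
    rw [← smul_eq_C_mul, map_smul, divDenPow_num_pow_mul, map_pow, RatFunc.algebraMap_X]
    rfl
  rw [← sub_add_cancel f (C c * (numPoly a e ^ n * X ^ ε)), map_add, htop]
  refine add_mem (Submodule.span_mono (Set.image_mono ?_) hrest) (Submodule.smul_mem _ _
    (Submodule.subset_span (Set.mem_image_of_mem _ ?_)))
  · exact Finset.coe_subset.2 (Finset.subset_insert _ _)
  · exact Finset.mem_insert_self _ _

lemma span_exponents_eq_map_numerators (hco : IsCoprime (numPoly a e) (denPoly d)) (hε : ε ≤ 1)
    (hεn : ε ≤ 2 * n) :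
    Submodule.span ℝ (bivariateMonomial (h3 a d e) RatFunc.X '' exponents ε n) =
      (numerators a d e ε n).map (divDenPow d n) :=
  (span_exponents_le_map_numerators hεn).antisymm (map_numerators_le_span_exponents hco hε)

lemma S_eq_map_numerators (hco : IsCoprime (numPoly a e) (denPoly d)) (n : ℕ) :
    S a d e n = (numerators a d e 0 n).map (divDenPow d n) := by
  rw [S, basisS_eq_image, span_exponents_eq_map_numerators hco zero_le_one (Nat.zero_le _)]

lemma T_eq_map_numerators (hco : IsCoprime (numPoly a e) (denPoly d)) (hn : n ≠ 0) :
    T a d e n = (numerators a d e 1 n).map (divDenPow d n) := by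
  rw [T, basisT_eq_image, span_exponents_eq_map_numerators hco le_rfl (by omega)]

lemma map_numerators_le_T (hco : IsCoprime (numPoly a e) (denPoly d)) (n : ℕ) :
    (numerators a d e 1 n).map (divDenPow d n) ≤ T a d e n := by
  rw [T, basisT_eq_image]
  exact map_numerators_le_span_exponents hco le_rfl

end Numerators

/-! ### Sums of two squares with prescribed residues -/

lemma exists_unit_parallel (x y : ℝ) : ∃ u v : ℝ, u ^ 2 + v ^ 2 = 1 ∧ u * y = v * x := by
  refine ⟨Real.cos (Complex.arg ⟨x, y⟩), Real.sin (Complex.arg ⟨x, y⟩),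
    Real.cos_sq_add_sin_sq _, ?_⟩
  have hx := Complex.norm_mul_cos_arg ⟨x, y⟩
  have hy := Complex.norm_mul_sin_arg ⟨x, y⟩
  dsimp only at hx hy
  linear_combination Real.sin (Complex.arg ⟨x, y⟩) * hx - Real.cos (Complex.arg ⟨x, y⟩) * hy

lemma exists_rotation {f₀ f₁ g₀ g₁ : ℝ} (h : f₀ * f₁ + g₀ * g₁ = 0) :
    ∃ u v : ℝ, u ^ 2 + v ^ 2 = 1 ∧ u * f₁ + v * g₁ = 0 ∧ u * g₀ - v * f₀ = 0 := by
  by_cases h₁ : f₁ = 0 ∧ g₁ = 0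
  · obtain ⟨rfl, rfl⟩ := h₁
    obtain ⟨u, v, huv, hpar⟩ := exists_unit_parallel f₀ g₀
    exact ⟨u, v, huv, by ring, sub_eq_zero.2 hpar⟩
  · obtain ⟨u, v, huv, hpar⟩ := exists_unit_parallel g₁ (-f₁)
    have horth : u * f₁ + v * g₁ = 0 := by linear_combination -hpar
    refine ⟨u, v, huv, horth, ?_⟩
    by_contra hne
    -- `(f₁, g₁)` is orthogonal to both `(u, v)` and `(f₀, g₀)`, whose determinant is nonzero.
    exact h₁ ⟨mul_left_cancel₀ hne (by linear_combination g₀ * horth - v * h),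
      mul_left_cancel₀ hne (by linear_combination u * h - f₀ * horth)⟩

lemma mul_add_mul_eq_zero_of_denPoly_dvd {d c f₀ f₁ g₀ g₁ : ℝ}
    (h : denPoly d ∣ (C f₁ * X + C f₀) ^ 2 + (C g₁ * X + C g₀) ^ 2 - C c) :
    f₀ * f₁ + g₀ * g₁ = 0 := by
  have hlin : denPoly d ∣ C (2 * (f₀ * f₁ + g₀ * g₁)) * X +
      C (f₀ ^ 2 + g₀ ^ 2 + d * (f₁ ^ 2 + g₁ ^ 2) - c) := by
    convert h.sub (dvd_mul_right (denPoly d) (C (f₁ ^ 2 + g₁ ^ 2))) using 1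
    simp only [denPoly, C_add, C_sub, C_mul, C_pow, C_ofNat]
    ring
  have hzero := eq_zero_of_dvd_of_natDegree_lt hlin
    (natDegree_linear_le.trans_lt (by rw [natDegree_denPoly]; exact one_lt_two))
  have hcoeff : 2 * (f₀ * f₁ + g₀ * g₁) = 0 := by
    simpa only [coeff_add, coeff_C_mul, coeff_X_one, coeff_C_succ, coeff_zero, mul_one, add_zero]
      using congrArg (coeff · 1) hzero
  linarith

lemma dvd_sq_add_sq_sub_of_isCoprime {R : Type*} [CommRing R] {D M F G r s c : R}
    (hMD : IsCoprime M D) (hF : D ∣ F - r * M) (hG : D ∣ G - s * M)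
    (h : D ∣ F ^ 2 + G ^ 2 - c * M ^ 2) : D ∣ r ^ 2 + s ^ 2 - c := by
  refine (hMD.symm.pow_right (n := 2)).dvd_of_dvd_mul_right ?_
  convert (h.sub (hF.mul_right (F + r * M))).sub (hG.mul_right (G + s * M)) using 1
  ring

lemma dvd_linear_combination_sub {R : Type*} [CommRing R] {D F G M : R[X]} {f₀ f₁ g₀ g₁ : R}
    (u v : R) (hF : D ∣ F - (C f₁ * X + C f₀) * M)
    (hG : D ∣ G - (C g₁ * X + C g₀) * M) :
    D ∣ C u * F + C v * G - (C (u * f₁ + v * g₁) * X + C (u * f₀ + v * g₀)) * M := by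
  convert (hF.mul_left (C u)).add (hG.mul_left (C v)) using 1
  simp only [C_add, C_mul]
  ring

lemma exists_mem_numerators_sq_add_sq {a d e : ℝ} (hco : IsCoprime (numPoly a e) (denPoly d))
    {n : ℕ} {p : ℝ[X]} (hp : p ∈ numerators a d e 0 (2 * n)) (hpos : ∀ t, 0 ≤ p.eval t) :
    ∃ f ∈ numerators a d e 0 n, ∃ g ∈ numerators a d e 1 n, p = f ^ 2 + g ^ 2 := by
  obtain ⟨hdeg, c, hc⟩ := mem_numerators.1 hp
  obtain ⟨F, G, rfl⟩ := exists_eq_sq_add_sq_of_nonneg p hpos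
  have hFdeg := two_mul_natDegree_le_natDegree_sq_add_sq F G
  have hGdeg := two_mul_natDegree_le_natDegree_sq_add_sq G F
  rw [add_comm] at hGdeg
  have hcop := hco.pow_left (m := n)
  obtain ⟨f₀, f₁, hF⟩ :=
    exists_dvd_sub_linear_mul (monic_denPoly d) (natDegree_denPoly d) hcop F
  obtain ⟨g₀, g₁, hG⟩ :=
    exists_dvd_sub_linear_mul (monic_denPoly d) (natDegree_denPoly d) hcop G
  have horth : f₀ * f₁ + g₀ * g₁ = 0 := by
    rw [pow_zero, mul_one, pow_mul'] at hc
    exact mul_add_mul_eq_zero_of_denPoly_dvd (dvd_sq_add_sq_sub_of_isCoprime hcop hF hG hc)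
  obtain ⟨u, v, huv, hf₁, hg₀⟩ := exists_rotation horth
  have hcomb (x y : ℝ) : (C x * F + C y * G).natDegree ≤ 3 * n :=
    natDegree_add_le_of_degree_le ((natDegree_C_mul_le _ _).trans (by omega))
      ((natDegree_C_mul_le _ _).trans (by omega))
  refine ⟨C u * F + C v * G, mem_numerators.2 ⟨hcomb _ _, u * f₀ + v * g₀, ?_⟩,
    C (-v) * F + C u * G, mem_numerators.2 ⟨hcomb _ _, -v * f₁ + u * g₁, ?_⟩, ?_⟩
  · simpa [hf₁] using dvd_linear_combination_sub u v hF hG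
  · have hg₀' : -v * f₀ + u * g₀ = 0 := by linear_combination hg₀
    have hres := dvd_linear_combination_sub (-v) u hF hG
    rwa [hg₀', C_0, add_zero, mul_right_comm, mul_assoc, ← pow_one X] at hres
  · have huv' : C u ^ 2 + C v ^ 2 = 1 := by rw [← C_pow, ← C_pow, ← C_add, huv, C_1]
    simp only [C_neg]
    linear_combination (-F ^ 2 - G ^ 2) * huv'

theorem exists_sq_add_sq_of_mem_PosS {a d e : ℝ} (hco : IsCoprime (numPoly a e) (denPoly d))
    {k : ℕ} {p : RatFunc ℝ} (hp : p ∈ PosS a d e (2 * k)) :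
    ∃ f ∈ S a d e k, ∃ g ∈ T a d e k, p = f ^ 2 + g ^ 2 := by
  obtain ⟨hpS, hpos⟩ := hp
  rw [S_eq_map_numerators hco] at hpS
  obtain ⟨q, hq, rfl⟩ := hpS
  obtain ⟨f, hf, g, hg, rfl⟩ :=
    exists_mem_numerators_sq_add_sq hco hq (eval_nonneg_of_divDenPow hpos)
  refine ⟨divDenPow d k f, ?_, divDenPow d k g,
    map_numerators_le_T hco k (Submodule.mem_map_of_mem hg), ?_⟩
  · rw [S_eq_map_numerators hco]
    exact Submodule.mem_map_of_mem hf
  · rw [map_add, divDenPow_sq, divDenPow_sq]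

/-! ### Sums of squares are nonnegative -/

section SumSq

variable {a d e : ℝ}

lemma sq_mem_S_of_mem_S (hco : IsCoprime (numPoly a e) (denPoly d)) {n : ℕ} {r : RatFunc ℝ}
    (hr : r ∈ S a d e n) : r ^ 2 ∈ S a d e (2 * n) := by
  rw [S_eq_map_numerators hco] at hr ⊢
  obtain ⟨f, hf, rfl⟩ := hr
  exact ⟨f ^ 2, sq_mem_numerators hf, (divDenPow_sq d n f).symm⟩

lemma sq_mem_S_of_mem_T (hco : IsCoprime (numPoly a e) (denPoly d)) {n : ℕ} (hn : n ≠ 0)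
    {r : RatFunc ℝ} (hr : r ∈ T a d e n) : r ^ 2 ∈ S a d e (2 * n) := by
  rw [T_eq_map_numerators hco hn] at hr
  rw [S_eq_map_numerators hco]
  obtain ⟨f, hf, rfl⟩ := hr
  exact ⟨f ^ 2, sq_mem_numerators hf, (divDenPow_sq d n f).symm⟩

lemma span_bivariateMonomial_le_regularAt {K : Type*} [Field K] {t : K} {u v : RatFunc K}
    (hu : u ∈ regularAt t) (hv : v ∈ regularAt t) (s : Set (ℕ × ℕ)) :
    Submodule.span K (bivariateMonomial u v '' s) ≤ (regularAt t).toSubmodule := by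
  rw [Submodule.span_le, Set.image_subset_iff]
  exact fun p _ => mul_mem (pow_mem hu p.1) (pow_mem hv p.2)

lemma mem_regularAt_of_mem_S {t : ℝ} (ht : t ^ 2 ≠ d) {n : ℕ} {r : RatFunc ℝ}
    (hr : r ∈ S a d e n) : r ∈ regularAt t := by
  rw [S, basisS_eq_image] at hr
  exact span_bivariateMonomial_le_regularAt (h3_mem_regularAt a e ht) (X_mem_regularAt t) _ hr

lemma mem_regularAt_of_mem_T {t : ℝ} (ht : t ^ 2 ≠ d) {n : ℕ} {r : RatFunc ℝ}
    (hr : r ∈ T a d e n) : r ∈ regularAt t := by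
  rw [T, basisT_eq_image] at hr
  exact span_bivariateMonomial_le_regularAt (h3_mem_regularAt a e ht) (X_mem_regularAt t) _ hr

theorem sum_sq_add_sum_sq_mem_PosS (hco : IsCoprime (numPoly a e) (denPoly d)) {k : ℕ}
    (hk : k ≠ 0) {ι κ : Type*} [Fintype ι] [Fintype κ] {f : ι → RatFunc ℝ} {g : κ → RatFunc ℝ}
    (hf : ∀ i, f i ∈ S a d e k) (hg : ∀ j, g j ∈ T a d e k) :
    ∑ i, f i ^ 2 + ∑ j, g j ^ 2 ∈ PosS a d e (2 * k) := by
  refine ⟨add_mem (sum_mem fun i _ => sq_mem_S_of_mem_S hco (hf i))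
    (sum_mem fun j _ => sq_mem_S_of_mem_T hco hk (hg j)), fun t ht => ?_⟩
  have hreg : ∀ i, Sum.elim f g i ∈ regularAt t :=
    Sum.rec (fun i => mem_regularAt_of_mem_S ht (hf i)) fun j => mem_regularAt_of_mem_T ht (hg j)
  simpa [Fintype.sum_sum_type] using eval_sum_sq_nonneg hreg

end SumSq

/-! ### Dimensions and linear independence -/

section Dimension

variable {a d e : ℝ} {ε n : ℕ}

lemma degreeLT_le_numerators_sup (hco : IsCoprime (numPoly a e) (denPoly d)) (hε : ε ≤ 1)
    (hn : n ≠ 0) : degreeLT ℝ (3 * n + 1) ≤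
      numerators a d e ε n ⊔ Submodule.span ℝ {numPoly a e ^ n * X ^ (1 - ε)} := by
  intro f hf
  rw [degreeLT_succ_eq_degreeLE, mem_degreeLE, ← natDegree_le_iff_degree_le] at hf
  suffices h : ∃ c b : ℝ, denPoly d ∣
      f - C b * (numPoly a e ^ n * X ^ (1 - ε)) - C c * (numPoly a e ^ n * X ^ ε) by
    obtain ⟨c, b, hcb⟩ := h
    refine Submodule.mem_sup.2 ⟨_, mem_numerators.2 ⟨?_, c, hcb⟩, _,
      Submodule.mem_span_singleton.2 ⟨b, smul_eq_C_mul b⟩, sub_add_cancel _ _⟩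
    refine (natDegree_sub_le_of_le hf ((natDegree_C_mul_le _ _).trans
      (natDegree_num_pow_mul_X_pow_le a e n (1 - ε)))).trans ?_
    omega
  obtain ⟨α, β, h⟩ := exists_dvd_sub_linear_mul (monic_denPoly d) (natDegree_denPoly d)
    (hco.pow_left (m := n)) f
  interval_cases ε
  · exact ⟨α, β, by convert h using 1; ring⟩
  · exact ⟨β, α, by convert h using 1; ring⟩

lemma three_mul_le_finrank_numerators (hco : IsCoprime (numPoly a e) (denPoly d)) (hε : ε ≤ 1)
    (hn : n ≠ 0) : 3 * n ≤ Module.finrank ℝ (numerators a d e ε n) := by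
  have : FiniteDimensional ℝ (degreeLT ℝ (3 * n + 1)) :=
    (degreeLTEquiv ℝ (3 * n + 1)).symm.finiteDimensional
  have : FiniteDimensional ℝ (numerators a d e ε n) :=
    Submodule.finiteDimensional_of_le inf_le_left
  have hdegreeLT : Module.finrank ℝ (degreeLT ℝ (3 * n + 1)) = 3 * n + 1 := by
    rw [(degreeLTEquiv ℝ (3 * n + 1)).finrank_eq, Module.finrank_fin_fun]
  have hle := Submodule.finrank_mono (degreeLT_le_numerators_sup hco hε hn)
  have hsup := Submodule.finrank_add_le_finrank_add_finrank (numerators a d e ε n)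
    (Submodule.span ℝ {numPoly a e ^ n * X ^ (1 - ε)})
  have hspan := finrank_span_le_card (R := ℝ) {numPoly a e ^ n * X ^ (1 - ε)}
  rw [Set.toFinset_singleton, Finset.card_singleton] at hspan
  omega

lemma finrank_span_exponents (hco : IsCoprime (numPoly a e) (denPoly d)) (hε : ε ≤ 1)
    (hn : n ≠ 0) : Module.finrank ℝ
      (Submodule.span ℝ (bivariateMonomial (h3 a d e) RatFunc.X '' exponents ε n)) = 3 * n := by
  classical
  refine le_antisymm ?_ ?_
  · rw [← Finset.coe_image]
    exact (finrank_span_finset_le_card _).trans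
      (Finset.card_image_le.trans (card_exponents_le ε hn))
  · rw [span_exponents_eq_map_numerators hco hε (by omega),
      ← (Submodule.equivMapOfInjective _ (divDenPow_injective d n) _).finrank_eq]
    exact three_mul_le_finrank_numerators hco hε hn

theorem linearIndepOn_exponents (hco : IsCoprime (numPoly a e) (denPoly d)) (hε : ε ≤ 1)
    (hn : n ≠ 0) :
    LinearIndepOn ℝ (bivariateMonomial (h3 a d e) RatFunc.X) (exponents ε n : Set (ℕ × ℕ)) := by
  refine linearIndependent_iff_card_le_finrank_span.2 ?_
  rw [Set.finrank, ← Set.image_eq_range, finrank_span_exponents hco hε hn]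
  exact (Fintype.card_coe _).trans_le (card_exponents_le ε hn)

lemma finrank_T (hco : IsCoprime (numPoly a e) (denPoly d)) (hn : n ≠ 0) :
    Module.finrank ℝ (T a d e n) = 3 * n := by
  rw [T, basisT_eq_image, finrank_span_exponents hco le_rfl hn]

end Dimension

/-! ### The parametrization of the curve -/

section Curve

/-- The point of the curve with parameter `t`. At `t ^ 2 = d`, where the parametrization is
undefined, its abscissa is the junk value `0`. -/
noncomputable def curvePoint (a d e t : ℝ) : Fin 2 → ℝ := ![(-a * t + e) / (t ^ 2 - d), t]

variable {a d e : ℝ}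

lemma mem_curve {z : Fin 2 → ℝ} : z ∈ curve a d e ↔ z 0 * (z 1 ^ 2 - d) = -a * z 1 + e := by
  simp only [curve, cubic, Set.mem_ofPred_eq, map_sub, map_add, map_mul, map_pow,
    MvPolynomial.eval_X, MvPolynomial.eval_C]
  constructor <;> intro h <;> linear_combination h

lemma curvePoint_mem_curve (a e : ℝ) {t : ℝ} (ht : t ^ 2 ≠ d) :
    curvePoint a d e t ∈ curve a d e := by
  simp [mem_curve, curvePoint, div_mul_cancel₀ _ (sub_ne_zero.2 ht)]

lemma sq_ne_of_mem_curve (hco : IsCoprime (numPoly a e) (denPoly d)) {z : Fin 2 → ℝ}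
    (hz : z ∈ curve a d e) : z 1 ^ 2 ≠ d := by
  intro h
  have hnum : (numPoly a e).eval (z 1) = 0 := by
    rw [eval_numPoly, ← mem_curve.1 hz, h, sub_self, mul_zero]
  have hden : (denPoly d).eval (z 1) = 0 := by rw [eval_denPoly, h, sub_self]
  obtain ⟨u, v, huv⟩ := hco
  simpa [hnum, hden] using congrArg (eval (z 1)) huv

lemma eq_curvePoint_of_mem_curve (hco : IsCoprime (numPoly a e) (denPoly d)) {z : Fin 2 → ℝ}
    (hz : z ∈ curve a d e) : z = curvePoint a d e (z 1) := by
  ext i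
  fin_cases i
  · exact (eq_div_iff (sub_ne_zero.2 (sq_ne_of_mem_curve hco hz))).2 (mem_curve.1 hz)
  · rfl

lemma continuousAt_curvePoint (a e : ℝ) {t : ℝ} (ht : t ^ 2 ≠ d) :
    ContinuousAt (curvePoint a d e) t := by
  refine continuousAt_pi.2 fun i => ?_
  fin_cases i
  · exact ContinuousAt.div (by fun_prop) (by fun_prop) (sub_ne_zero.2 ht)
  · exact continuousAt_id

lemma curvePoint_mem_nonIsolated (a e : ℝ) {t : ℝ} (ht : t ^ 2 ≠ d) :
    curvePoint a d e t ∈ nonIsolated (curve a d e) := by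
  refine ⟨curvePoint_mem_curve a e ht, accPt_iff_nhds.2 fun U hU => ?_⟩
  have hne : ∀ᶠ s in nhds t, s ^ 2 ≠ d := (continuousAt_id.pow 2).eventually_ne ht
  have hnear := (hne.and ((continuousAt_curvePoint a e ht).eventually_mem hU)).filter_mono
    (nhdsWithin_le_nhds (s := {t}ᶜ))
  obtain ⟨s, ⟨hs, hsU⟩, hst⟩ := (hnear.and self_mem_nhdsWithin).exists
  exact ⟨_, ⟨hsU, curvePoint_mem_curve a e hs⟩, fun h => hst (congrFun h 1)⟩

lemma aeval_mem_regularAt {K σ : Type*} [Field K] {t : K} {u : σ → RatFunc K}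
    (hu : ∀ i, u i ∈ regularAt t) (F : MvPolynomial σ K) :
    MvPolynomial.aeval u F ∈ regularAt t := by
  lift u to σ → regularAt t using hu
  exact MvPolynomial.comp_aeval_apply u (regularAt t).val F ▸ (MvPolynomial.aeval u F).2

lemma ratFunc_eval_aeval {K σ : Type*} [Field K] {t : K} {u : σ → RatFunc K}
    (hu : ∀ i, u i ∈ regularAt t) (F : MvPolynomial σ K) :
    RatFunc.eval (RingHom.id K) t (MvPolynomial.aeval u F) =
      MvPolynomial.aeval (fun i => RatFunc.eval (RingHom.id K) t (u i)) F := by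
  lift u to σ → regularAt t using hu
  have hcoe := MvPolynomial.comp_aeval_apply u (regularAt t).val F
  exact (congrArg _ hcoe.symm).trans (MvPolynomial.comp_aeval_apply u (evalRegularAt t) F)

lemma h3_X_mem_regularAt (a e : ℝ) {t : ℝ} (ht : t ^ 2 ≠ d) (i : Fin 2) :
    ![h3 a d e, RatFunc.X] i ∈ regularAt t := by
  fin_cases i
  exacts [h3_mem_regularAt a e ht, X_mem_regularAt t]

lemma ratFunc_eval_h3 (a e : ℝ) {t : ℝ} (ht : t ^ 2 ≠ d) :
    RatFunc.eval (RingHom.id ℝ) t (h3 a d e) = (-a * t + e) / (t ^ 2 - d) := by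
  rw [eq_div_iff (sub_ne_zero.2 ht), ← eval_denPoly,
    ← eval_mul_algebraMap (h3_mem_regularAt a e ht), h3_eq_div,
    div_mul_cancel₀ _ (algebraMap_denPoly_ne_zero d), ratFunc_eval_algebraMap, eval_numPoly]

lemma ratFunc_eval_aeval_h3_X (a e : ℝ) {t : ℝ} (ht : t ^ 2 ≠ d)
    (F : MvPolynomial (Fin 2) ℝ) :
    RatFunc.eval (RingHom.id ℝ) t (MvPolynomial.aeval ![h3 a d e, RatFunc.X] F) =
      MvPolynomial.aeval (curvePoint a d e t) F := by
  rw [ratFunc_eval_aeval (h3_X_mem_regularAt a e ht)]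
  congr 2
  ext i
  fin_cases i
  · exact ratFunc_eval_h3 a e ht
  · exact RatFunc.eval_X _ _

lemma aeval_eq_zero_of_mem_vanishingIdeal {F : MvPolynomial (Fin 2) ℝ}
    (hF : F ∈ MvPolynomial.vanishingIdeal ℝ (curve a d e)) :
    MvPolynomial.aeval ![h3 a d e, RatFunc.X] F = 0 := by
  refine eq_zero_of_infinite_eval_eq_zero (finite_setOf_sq_eq d).infinite_compl
    (fun t ht => aeval_mem_regularAt (h3_X_mem_regularAt a e ht) F) fun t ht => ?_
  rw [ratFunc_eval_aeval_h3_X a e ht]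
  exact hF _ (curvePoint_mem_curve a e ht)

variable (a d e) in
/-- The homomorphism `ℝ[C] → ℝ(t)` with `x ↦ h₃` and `y ↦ t`, which pulls functions on the curve
back along the parametrization `curvePoint`. -/
noncomputable def paramHom : CoordRing (curve a d e) →ₐ[ℝ] RatFunc ℝ :=
  Ideal.Quotient.liftₐ (MvPolynomial.vanishingIdeal ℝ (curve a d e))
    (MvPolynomial.aeval ![h3 a d e, RatFunc.X]) fun _ => aeval_eq_zero_of_mem_vanishingIdeal

lemma paramHom_restrict (F : MvPolynomial (Fin 2) ℝ) :
    paramHom a d e (restrict (curve a d e) F) =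
      MvPolynomial.aeval ![h3 a d e, RatFunc.X] F := rfl

@[simp]
lemma paramHom_xC (a d e : ℝ) : paramHom a d e (xC a d e) = h3 a d e := by
  simp [xC, paramHom_restrict]

@[simp]
lemma paramHom_yC (a d e : ℝ) : paramHom a d e (yC a d e) = RatFunc.X := by
  simp [yC, paramHom_restrict]

lemma evalAt_curvePoint {t : ℝ} (ht : t ^ 2 ≠ d) (p : CoordRing (curve a d e)) :
    evalAt (curve a d e) ⟨curvePoint a d e t, curvePoint_mem_curve a e ht⟩ p =
      RatFunc.eval (RingHom.id ℝ) t (paramHom a d e p) := by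
  obtain ⟨F, rfl⟩ := Ideal.Quotient.mk_surjective p
  exact (ratFunc_eval_aeval_h3_X a e ht F).symm

lemma evalAt_eq_eval_paramHom (hco : IsCoprime (numPoly a e) (denPoly d)) (z : curve a d e)
    (p : CoordRing (curve a d e)) :
    evalAt (curve a d e) z p = RatFunc.eval (RingHom.id ℝ) (z.1 1) (paramHom a d e p) := by
  rw [← evalAt_curvePoint (sq_ne_of_mem_curve hco z.2)]
  congr 2
  exact Subtype.ext (eq_curvePoint_of_mem_curve hco z.2)

lemma paramHom_injective (hco : IsCoprime (numPoly a e) (denPoly d)) :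
    Function.Injective (paramHom a d e) := by
  refine (injective_iff_map_eq_zero _).2 fun p hp => ?_
  have hvanish (z : curve a d e) : evalAt (curve a d e) z p = 0 := by
    rw [evalAt_eq_eval_paramHom hco, hp, RatFunc.eval_zero]
  obtain ⟨F, rfl⟩ := Ideal.Quotient.mk_surjective p
  exact Ideal.Quotient.eq_zero_iff_mem.2 fun z hz => hvanish ⟨z, hz⟩

/-- The extension of `paramHom` to the total ring of fractions. -/
noncomputable def fracHom (hco : IsCoprime (numPoly a e) (denPoly d)) :
    TotalFrac (curve a d e) →ₐ[ℝ] RatFunc ℝ :=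
  IsLocalization.liftAlgHom (f := paramHom a d e)
    (IsFractionRing.isUnit_map_of_injective (paramHom_injective hco))

@[simp]
lemma fracHom_algebraMap (hco : IsCoprime (numPoly a e) (denPoly d))
    (p : CoordRing (curve a d e)) :
    fracHom hco (algebraMap _ (TotalFrac (curve a d e)) p) = paramHom a d e p := by
  rw [fracHom, IsLocalization.liftAlgHom_apply]
  exact IsLocalization.lift_eq _ _

lemma fracHom_injective (hco : IsCoprime (numPoly a e) (denPoly d)) :
    Function.Injective (fracHom hco) :=
  (IsLocalization.lift_injective_iff _).2 fun _ _ =>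
    (IsFractionRing.injective _ (TotalFrac (curve a d e))).eq_iff.trans
      (paramHom_injective hco).eq_iff.symm

end Curve

/-! ### Transfer between the curve and the parameter line -/

section Transfer

variable {a d e : ℝ} {k : ℕ}

lemma map_span_basisB (a d e : ℝ) (k : ℕ) :
    (Submodule.span ℝ (basisB a d e k)).map (paramHom a d e).toLinearMap = S a d e k := by
  rw [Submodule.map_span, AlgHom.coe_toLinearMap, basisB, basisS_eq_image, ← Set.image_comp,
    comp_bivariateMonomial, paramHom_xC, paramHom_yC, ← basisS_eq_image, S]

lemma map_V (hco : IsCoprime (numPoly a e) (denPoly d)) (k : ℕ) :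
    (V a d e k).map (fracHom hco).toLinearMap = T a d e k := by
  rw [V, Submodule.map_span, AlgHom.coe_toLinearMap, basisV, basisT_eq_image, ← Set.image_comp,
    comp_bivariateMonomial, fracHom_algebraMap, fracHom_algebraMap, paramHom_xC, paramHom_yC,
    ← basisT_eq_image, T]

lemma linearIndepOn_basisB (hco : IsCoprime (numPoly a e) (denPoly d)) (hk : k ≠ 0) :
    LinearIndepOn ℝ id (basisB a d e k) := by
  rw [basisB, basisS_eq_image]
  refine (LinearIndepOn.of_comp (paramHom a d e).toLinearMap ?_).id_image
  rw [AlgHom.coe_toLinearMap, comp_bivariateMonomial, paramHom_xC, paramHom_yC]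
  exact linearIndepOn_exponents hco zero_le_one hk

lemma linearIndepOn_basisV (hco : IsCoprime (numPoly a e) (denPoly d)) (hk : k ≠ 0) :
    LinearIndepOn ℝ id (basisV a d e k) := by
  rw [basisV, basisT_eq_image]
  refine (LinearIndepOn.of_comp (fracHom hco).toLinearMap ?_).id_image
  rw [AlgHom.coe_toLinearMap, comp_bivariateMonomial, fracHom_algebraMap, fracHom_algebraMap,
    paramHom_xC, paramHom_yC]
  exact linearIndepOn_exponents hco le_rfl hk

lemma finrank_V (hco : IsCoprime (numPoly a e) (denPoly d)) (hk : k ≠ 0) :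
    Module.finrank ℝ (V a d e k) = 3 * k := by
  rw [← finrank_T hco hk, ← map_V hco]
  exact (Submodule.equivMapOfInjective _ (fracHom_injective hco) _).finrank_eq

lemma bivariateMonomial_mem_coordDegLE {m l : ℕ} (h : m + l ≤ k) :
    bivariateMonomial (xC a d e) (yC a d e) (m, l) ∈ coordDegLE (curve a d e) k := by
  refine ⟨MvPolynomial.X 0 ^ m * MvPolynomial.X 1 ^ l,
    (MvPolynomial.mem_restrictTotalDegree _ _ _).2 ((MvPolynomial.totalDegree_mul _ _).trans ?_),
    by simp [bivariateMonomial, xC, yC]⟩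
  rwa [MvPolynomial.totalDegree_X_pow, MvPolynomial.totalDegree_X_pow]

lemma bivariateMonomial_mem_S (hco : IsCoprime (numPoly a e) (denPoly d)) {m l : ℕ}
    (h : m + l ≤ k) : bivariateMonomial (h3 a d e) RatFunc.X (m, l) ∈ S a d e k := by
  rw [S_eq_map_numerators hco]
  exact bivariateMonomial_mem_map_numerators (by omega) (by omega) (by omega)

lemma map_coordDegLE_le_S (hco : IsCoprime (numPoly a e) (denPoly d)) (k : ℕ) :
    (coordDegLE (curve a d e) k).map (paramHom a d e).toLinearMap ≤ S a d e k := by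
  rintro _ ⟨_, ⟨F, hF, rfl⟩, rfl⟩
  simp only [AlgHom.toLinearMap_apply, paramHom_restrict]
  rw [F.as_sum, map_sum]
  refine Submodule.sum_mem _ fun s hs => ?_
  have hdeg : s 0 + s 1 ≤ k := by
    have hsF := (MvPolynomial.le_totalDegree hs).trans
      ((MvPolynomial.mem_restrictTotalDegree _ _ _).1 hF)
    rwa [Finsupp.sum_fintype _ _ (fun _ => rfl), Fin.sum_univ_two] at hsF
  rw [MvPolynomial.aeval_monomial, ← Algebra.smul_def,
    Finsupp.prod_fintype _ _ (fun _ => pow_zero _), Fin.prod_univ_two]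
  exact Submodule.smul_mem _ _ (bivariateMonomial_mem_S hco hdeg)

theorem span_basisB (hco : IsCoprime (numPoly a e) (denPoly d)) (k : ℕ) :
    Submodule.span ℝ (basisB a d e k) = coordDegLE (curve a d e) k := by
  refine le_antisymm ?_ ?_
  · rw [Submodule.span_le, basisB, basisS_eq_image, Set.image_subset_iff]
    rintro ⟨m, l⟩ h
    refine bivariateMonomial_mem_coordDegLE ?_
    rw [Finset.mem_coe, mem_exponents, mem_lowExponents] at h
    omega
  · exact (Submodule.map_le_map_iff_of_injective (f := (paramHom a d e).toLinearMap)
      (paramHom_injective hco) _ _).1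
      ((map_coordDegLE_le_S hco k).trans_eq (map_span_basisB a d e k).symm)

lemma map_coordDegLE (hco : IsCoprime (numPoly a e) (denPoly d)) (k : ℕ) :
    (coordDegLE (curve a d e) k).map (paramHom a d e).toLinearMap = S a d e k := by
  rw [← span_basisB hco, map_span_basisB]

lemma paramHom_mem_S_iff (hco : IsCoprime (numPoly a e) (denPoly d))
    {p : CoordRing (curve a d e)} :
    paramHom a d e p ∈ S a d e k ↔ p ∈ coordDegLE (curve a d e) k := by
  rw [← map_coordDegLE hco]
  exact (paramHom_injective hco).mem_set_image

lemma paramHom_mem_PosS_iff (hco : IsCoprime (numPoly a e) (denPoly d))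
    {p : CoordRing (curve a d e)} :
    paramHom a d e p ∈ PosS a d e k ↔
      p ∈ PosOn (curve a d e) (nonIsolated (curve a d e)) k := by
  refine and_congr (paramHom_mem_S_iff hco) ⟨fun hpos z _ => ?_, fun hpos t ht => ?_⟩
  · rw [evalAt_eq_eval_paramHom hco]
    exact hpos _ (sq_ne_of_mem_curve hco z.2)
  · rw [← evalAt_curvePoint ht]
    exact hpos _ (curvePoint_mem_nonIsolated a e ht)

theorem isCertificatePair (hco : IsCoprime (numPoly a e) (denPoly d)) :
    IsCertificatePair (curve a d e) 1 (V a d e) := by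
  intro k hk
  refine ⟨finrank_V hco (by omega), fun p => ?_⟩
  rw [← paramHom_mem_PosS_iff hco]
  constructor
  · intro hp
    obtain ⟨f, hf, g, hg, hfg⟩ := exists_sq_add_sq_of_mem_PosS hco hp
    rw [← map_coordDegLE hco] at hf
    rw [← map_V hco] at hg
    obtain ⟨f, hf, rfl⟩ := hf
    obtain ⟨g, hg, rfl⟩ := hg
    refine ⟨1, 1, fun _ => f, fun _ => g, fun _ => hf, fun _ => hg, fracHom_injective hco ?_⟩
    simpa using hfg
  · rintro ⟨m, n, g, h, hg, hh, hp⟩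
    have hsum : paramHom a d e p =
        ∑ i, paramHom a d e (g i) ^ 2 + ∑ j, fracHom hco (h j) ^ 2 := by
      simpa using congrArg (fracHom hco) hp
    rw [hsum]
    refine sum_sq_add_sum_sq_mem_PosS hco (by omega)
      (fun i => (paramHom_mem_S_iff hco).2 (hg i)) fun j => ?_
    exact map_V hco k ▸ Submodule.mem_map_of_mem (hh j)

end Transfer

/-! ### Irreducibility -/

lemma isUnit_of_isUnit_aeval_X {R σ : Type*} [CommRing R] {i : σ} {q : R[X]}
    (hq : IsUnit (aeval (MvPolynomial.X i : MvPolynomial σ R) q)) : IsUnit q := by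
  have h := hq.map (MvPolynomial.aeval fun _ : σ => (X : R[X]))
  rwa [← aeval_algHom_apply, MvPolynomial.aeval_X, aeval_X_left_apply] at h

lemma cubic_eq (a d e : ℝ) :
    cubic a d e = MvPolynomial.X 0 * aeval (MvPolynomial.X 1) (denPoly d) -
      aeval (MvPolynomial.X 1) (numPoly a e) := by
  simp only [cubic, denPoly, numPoly, map_sub, map_add, map_neg, map_mul, map_pow, aeval_X,
    aeval_C, MvPolynomial.algebraMap_eq]
  ring

lemma not_cubic_dvd_aeval_denPoly (a d e : ℝ) :
    ¬ cubic a d e ∣ aeval (MvPolynomial.X 1) (denPoly d) := by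
  intro hdvd
  obtain ⟨t, ht⟩ := (finite_setOf_sq_eq d).infinite_compl.nonempty
  have h := map_dvd (MvPolynomial.aeval (R := ℝ) (curvePoint a d e t)) hdvd
  have hcubic : MvPolynomial.aeval (curvePoint a d e t) (cubic a d e) = 0 :=
    curvePoint_mem_curve a e ht
  rw [hcubic, zero_dvd_iff, ← aeval_algHom_apply, MvPolynomial.aeval_X, coe_aeval_eq_eval,
    eval_denPoly] at h
  exact sub_ne_zero.2 ht h

theorem isCoprime_of_irreducible_cubic {a d e : ℝ} (hP : Irreducible (cubic a d e)) :
    IsCoprime (numPoly a e) (denPoly d) := by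
  rw [← EuclideanDomain.gcd_isUnit_iff]
  set g := EuclideanDomain.gcd (numPoly a e) (denPoly d)
  let ι : ℝ[X] →ₐ[ℝ] MvPolynomial (Fin 2) ℝ := aeval (MvPolynomial.X 1)
  have hnum : ι g ∣ ι (numPoly a e) := map_dvd ι (EuclideanDomain.gcd_dvd_left _ _)
  have hden : ι g ∣ ι (denPoly d) := map_dvd ι (EuclideanDomain.gcd_dvd_right _ _)
  obtain ⟨r, hr⟩ : ι g ∣ cubic a d e := cubic_eq a d e ▸ dvd_sub (hden.mul_left _) hnum
  refine isUnit_of_isUnit_aeval_X ((hP.isUnit_or_isUnit hr).resolve_right fun hunit => ?_)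
  refine not_cubic_dvd_aeval_denPoly a d e (.trans ?_ hden)
  rw [hr]
  exact hunit.mul_right_dvd.2 dvd_rfl

end RationalCubic

theorem theorem4p3 (a d e : ℝ) (hP : Irreducible (RationalCubic.cubic a d e)) :
    (∀ (k : ℕ) (p : RatFunc ℝ), p ∈ RationalCubic.PosS a d e (2 * k) →
      ∃ (m n : ℕ) (f : Fin m → RatFunc ℝ) (g : Fin n → RatFunc ℝ),
        (∀ i, f i ∈ RationalCubic.S a d e k) ∧ (∀ j, g j ∈ RationalCubic.T a d e k) ∧
        p = ∑ i, (f i) ^ 2 + ∑ j, (g j) ^ 2) ∧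
    RationalCubic.IsCertificatePair (RationalCubic.curve a d e) 1 (RationalCubic.V a d e) ∧
    (∀ k : ℕ, 1 ≤ k →
      LinearIndepOn ℝ id (RationalCubic.basisB a d e k) ∧
      Submodule.span ℝ (RationalCubic.basisB a d e k) =
        RationalCubic.coordDegLE (RationalCubic.curve a d e) k ∧
      LinearIndepOn ℝ id (RationalCubic.basisV a d e k)) := by
  have hco := RationalCubic.isCoprime_of_irreducible_cubic hP
  refine ⟨fun k p hp => ?_, RationalCubic.isCertificatePair hco, fun k hk => ?_⟩
  · obtain ⟨f, hf, g, hg, hfg⟩ := RationalCubic.exists_sq_add_sq_of_mem_PosS hco hp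
    exact ⟨1, 1, fun _ => f, fun _ => g, fun _ => hf, fun _ => hg, by simpa using hfg⟩
  · have hk0 : k ≠ 0 := Nat.one_le_iff_ne_zero.1 hk
    exact ⟨RationalCubic.linearIndepOn_basisB hco hk0, RationalCubic.span_basisB hco k,
      RationalCubic.linearIndepOn_basisV hco hk0⟩
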